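/- Let $X$ be a finite set and let $W$ be the automorphism group of the regular rooted tree with vertex set $X^*$ (the root is the empty word, and there is an edge between $v$ and $vx$ for all $v\in X^*$, $x\in X$). For $g\in W$ and $x\in X$ let $g@x\in W$ be the state of $g$ at $x$, i.e. the automorphism with $g(xv)=g(x)\,(g@x)(v)$ for all $v\in X^*$, and put $g@(x_1\cdots x_n)=g@x_1@\cdots@x_n$. A subgroup $G\le W$ is self-similar if $g@x\in G$ for all $g\in G$ and $x\in X$; a self-similar group $G$ is contracting if there is a finite subset $N\subseteq G$ such that for every $g\in G$ we have $g@v\in N$ for all sufficiently long words $v\in X^*$ (depending on $g$). Let $G\le W$ be a finitely generated contracting self-similar group. Let $S$ be any finite set with a surjective homomorphism from the free group over $S$ onto $G$, and let $\Sigma=S\cup S^{-1}\cup\{1\}$. Then the word problem $\{w\in\Sigma^* : w=_G 1\}$ is solvable in deterministic logarithmic space, i.e. it is decided by a deterministic Turing machine with a two-way read-only input tape which uses $O(\log n)$ cells of its work tapes on inputs of length $n$. Moreover, there is a constant $C\in\mathbb N$ (depending only on $G$, on $S$ and on the homomorphism) such that a word $w\in\Sigma^*$ satisfies $w=_G1$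 if and only if $w$ fixes all vertices $v\in X^*$ of depth $|v|=C\,(\lfloor\log_2\max(|w|,1)\rfloor+1)$. -/

import Mathlib

/-! ## Automorphisms of the regular rooted tree of words -/

/-- The edges of the regular rooted tree with vertex set `X^*`, directed away from the root (the
empty word): there is an edge from `v` to `v x` for every vertex `v` and every letter `x`. -/
def TreeEdge {X : Type*} (u v : List X) : Prop := ∃ x : X, v = u ++ [x]

/-- The group `W` of automorphisms of the rooted tree `X^*`. The product is the composition of
maps, `(g * h) v = g (h v)`. -/
abbrev TreeAut (X : Type*) := @TreeEdge X ≃r @TreeEdge X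

namespace TreeAut

variable {X : Type*}

theorem apply_nil (g : TreeAut X) : g [] = [] := by
  rcases List.eq_nil_or_concat (g []) with h | ⟨u, y, h⟩
  · exact h
  · exfalso
    have h2 : TreeEdge u (g []) := ⟨y, by simpa using h⟩
    have h3 : TreeEdge (g.symm u) [] := by
      have := g.symm.map_rel_iff.2 h2
      simpa using this
    obtain ⟨x, hx⟩ := h3
    simp at hx

theorem exists_apply_concat (g : TreeAut X) (v : List X) (x : X) :
    ∃ y, g (v ++ [x]) = g v ++ [y] :=
  g.map_rel_iff.2 ⟨x, rfl⟩

theorem exists_apply_singleton (g : TreeAut X) (x : X) : ∃ y, g [x] = [y] := by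
  obtain ⟨y, hy⟩ := g.exists_apply_concat [] x
  exact ⟨y, by simpa [g.apply_nil] using hy⟩

theorem apply_cons (g : TreeAut X) (x : X) (v : List X) :
    g (x :: v) = g [x] ++ (g (x :: v)).tail := by
  induction v using List.reverseRecOn with
  | nil =>
    obtain ⟨y, hy⟩ := g.exists_apply_singleton x
    simp [hy]
  | append_singleton v z ih =>
    obtain ⟨y, hy⟩ := g.exists_apply_singleton x
    obtain ⟨z', hz⟩ := g.exists_apply_concat (x :: v) z
    rw [hy] at ih
    rw [← List.cons_append, hz, ih, hy]
    simp

/-- The state `g@x` of `g` at the letter `x`: the automorphism with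
`g (x v) = g(x) (g@x)(v)` for all words `v`. -/
def state (g : TreeAut X) (x : X) : TreeAut X where
  toFun v := (g (x :: v)).tail
  invFun v := (g.symm (g [x] ++ v)).tail
  left_inv v := by
    simp only
    rw [← g.apply_cons x v]
    simp
  right_inv v := by
    simp only
    obtain ⟨y, hy⟩ := g.exists_apply_singleton x
    have hs : g.symm [y] = [x] := by rw [← hy]; simp
    have h := apply_cons g.symm y v
    rw [hs, List.singleton_append] at h
    rw [hy, List.singleton_append, ← h]
    simp
  map_rel_iff' {u v} := by
    obtain ⟨y, hy⟩ := g.exists_apply_singleton x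
    have hu := g.apply_cons x u
    have hv := g.apply_cons x v
    have h : TreeEdge (g (x :: u)) (g (x :: v)) ↔ TreeEdge (x :: u) (x :: v) := g.map_rel_iff
    rw [hu, hv, hy] at h
    simpa [TreeEdge] using h

/-- The defining property of the states. -/
theorem apply_cons_eq (g : TreeAut X) (x : X) (v : List X) :
    g (x :: v) = g [x] ++ g.state x v :=
  g.apply_cons x v

/-- The iterated state `g@v = g@x₁@⋯@xₙ` at a word `v = x₁⋯xₙ`. -/
def stateAt (g : TreeAut X) (v : List X) : TreeAut X := v.foldl state g

end TreeAut

/-- A group of tree automorphisms is self-similar if it contains all states of its elements. -/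
def IsSelfSimilar {X : Type*} (G : Subgroup (TreeAut X)) : Prop :=
  ∀ g ∈ G, ∀ x : X, TreeAut.state g x ∈ G

/-- `G` is contracting if there is a finite subset `N` of `G` such that for every `g` in `G` the
state `g@v` lies in `N` for all words `v` that are long enough (depending on `g`). -/
def IsContracting {X : Type*} (G : Subgroup (TreeAut X)) : Prop :=
  ∃ N : Set (TreeAut X), N ⊆ (G : Set (TreeAut X)) ∧ N.Finite ∧
    ∀ g ∈ G, ∃ n : ℕ, ∀ v : List X, n ≤ v.length → TreeAut.stateAt g v ∈ N

/-! ## The word problem -/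

/-- The letters of the standard alphabet `S ∪ S⁻¹ ∪ {1}` over a set `S` of generators. -/
inductive StdLetter (S : Type*) where
  | one : StdLetter S
  | gen : S → StdLetter S
  | inv : S → StdLetter S

/-- The element of the free group over `S` that a letter stands for. -/
def StdLetter.toFree {S : Type*} : StdLetter S → FreeGroup S
  | one => 1
  | gen s => FreeGroup.of s
  | inv s => (FreeGroup.of s)⁻¹

/-- The group element that is represented by a word over the standard alphabet. -/
def wordValue {S G : Type*} [Group G] (π : FreeGroup S →* G) (w : List (StdLetter S)) : G :=
  (w.map fun a => π a.toFree).prod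

/-- The word problem: the set of all words over the standard alphabet that represent `1`. -/
def wordProblem {S G : Type*} [Group G] (π : FreeGroup S →* G) : Language (StdLetter S) :=
  {w : List (StdLetter S) | wordValue π w = 1}

/-! ## Deterministic logarithmic space -/

/-- The contents of a cell of the input tape: a letter of the input or one of the two end
markers. -/
inductive InputSymbol (A : Type*) where
  | leftEnd : InputSymbol A
  | letter : A → InputSymbol A
  | rightEnd : InputSymbol A

/-- A movement of a head. -/
inductive HeadMove where
  | left
  | stay
  | right

/-- The displacement of a head on a two-sided infinite tape. -/
def HeadMove.shift : HeadMove → ℤ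
  | left => -1
  | stay => 0
  | right => 1

/-- A deterministic Turing machine with a two-way read-only input tape over the alphabet `A` and
finitely many read-write work tapes. -/
structure OfflineTM (A : Type*) where
  /-- the control states -/
  State : Type
  finiteState : Finite State
  /-- the alphabet of the work tapes -/
  Sym : Type
  finiteSym : Finite Sym
  blank : Sym
  /-- the number of work tapes -/
  tapes : ℕ
  start : State
  /-- `some true` in accepting, `some false` in rejecting, `none` in non-halting states -/
  verdict : State → Option Bool
  /-- From the control state, the scanned input symbol and the scanned work symbols: the new
  control state, the movement of the input head, and for each work tape the symbol that is written
  and the movement of the head. -/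
  trans : State → InputSymbol A → (Fin tapes → Sym) →
    State × HeadMove × (Fin tapes → Sym × HeadMove)

namespace OfflineTM

variable {A : Type*}

/-- The configurations of a machine. Position `0` on the input tape is the left end marker, the
positions `1, …, n` hold the letters of an input of length `n`, and `n + 1` is the right end
marker. The work tapes are infinite in both directions. -/
structure Cfg (M : OfflineTM A) where
  state : M.State
  inputPos : ℕ
  work : Fin M.tapes → ℤ → M.Sym
  head : Fin M.tapes → ℤ

/-- The symbol at a position of the input tape. -/
def inputSymbol (w : List A) : ℕ → InputSymbol A
  | 0 => .leftEnd
  | p + 1 => match w[p]? with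
    | some a => .letter a
    | none => .rightEnd

/-- The movement of the input head, which cannot leave the input with its two end markers. -/
def moveInput (n : ℕ) (p : ℕ) : HeadMove → ℕ
  | .left => p - 1
  | .stay => p
  | .right => min (p + 1) (n + 1)

/-- The initial configuration. -/
def init (M : OfflineTM A) : M.Cfg where
  state := M.start
  inputPos := 0
  work := fun _ _ => M.blank
  head := fun _ => 0

/-- One step of the machine on the input `w`; there is none from a halting state. -/
def step (M : OfflineTM A) (w : List A) (c : M.Cfg) : Option M.Cfg :=
  match M.verdict c.state with
  | some _ => none
  | none =>
    let t := M.trans c.state (inputSymbol w c.inputPos) (fun i => c.work i (c.head i))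
    some
      { state := t.1
        inputPos := moveInput w.length c.inputPos t.2.1
        work := fun i => Function.update (c.work i) (c.head i) (t.2.2 i).1
        head := fun i => c.head i + (t.2.2 i).2.shift }

/-- The configuration `c` occurs in the computation on the input `w`. -/
def Visits (M : OfflineTM A) (w : List A) (c : M.Cfg) : Prop :=
  Relation.ReflTransGen (fun a b => M.step w a = some b) M.init c

/-- The work tape cells that are scanned in the computation on the input `w`. -/
def scannedCells (M : OfflineTM A) (w : List A) : Set (Fin M.tapes × ℤ) :=
  {z | ∃ c : M.Cfg, M.Visits w c ∧ c.head z.1 = z.2}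

/-- The machine decides `L`: it halts on every input, and it accepts the words of `L` and rejects
all others. -/
def Decides (M : OfflineTM A) (L : Language A) : Prop :=
  ∀ w : List A, ∃ c : M.Cfg, M.Visits w c ∧
    ((w ∈ L ∧ M.verdict c.state = some true) ∨ (w ∉ L ∧ M.verdict c.state = some false))

end OfflineTM

/-- The class of languages that are decided by a deterministic Turing machine which scans
`O(log n)` work tape cells on every input of length `n`. -/
def InLogspace {A : Type*} (L : Language A) : Prop :=
  ∃ (M : OfflineTM A) (c : ℕ), M.Decides L ∧
    ∀ w : List A, (M.scannedCells w).encard ≤ ((c * (Nat.log 2 w.length + 1) : ℕ) : ℕ∞)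

/-! Contraction halves word length. The letters lie in a finite set `B` that is closed under states
and has a level `k` at which every product of two elements of `B` has its states in `B`
(`IsContracting.exists_finite_superset`). Pairing neighbouring factors shows that a product of `l`
elements of `B` has, at every vertex of depth `k`, a state that is a product of at most `(l + 1) /
2` elements of `B`; after `n` rounds a product of at most `2 ^ n` factors has its states in `B`
(`stateAt_prod_mem`). The finitely many nontrivial elements of `B` all move vertices of some common
depth `m`. A product that fixes level `(k + m) * n`, with `n > 0`, therefore has trivial states at
level `k * n`, and is trivial (`exists_prod_eq_one_iff`).

For logarithmic space, words of length `C` over `X` serve as single letters, on which `B` acts as a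
finite transducer (`inLogspace_of_fixesLevel`). It remains to test all vertices whose depth is the
binary size of the input length. The machine stores one vertex and its image, lets the input letters
act on the image one after the other, compares, and passes to the next vertex as an odometer does
(`Transducer.loop_reach`). Counting the input in binary beforehand allocates exactly the cells that
this needs. -/

/-! ## Bounded computations of offline machines -/

namespace OfflineTM

variable {A : Type*}

@[simp]
theorem moveInput_stay (n p : ℕ) : moveInput n p .stay = p := rfl

/-- A step from a configuration whose heads are at positions between `0` and `B`. -/
def BoundedStep (M : OfflineTM A) (w : List A) (B : ℕ) (c d : M.Cfg) : Prop :=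
  M.step w c = some d ∧ ∀ i, c.head i ∈ Set.Icc (0 : ℤ) B

theorem visits_of_boundedStep {M : OfflineTM A} {w : List A} {B : ℕ} {c : M.Cfg}
    (h : Relation.ReflTransGen (M.BoundedStep w B) M.init c) : M.Visits w c :=
  Relation.ReflTransGen.mono (fun _ _ h => h.1) _ _ h

/-- If a computation with bounded head positions reaches a halting configuration, then all visited
configurations have bounded head positions. -/
theorem head_mem_of_boundedStep {M : OfflineTM A} {w : List A} {B : ℕ} {a c : M.Cfg}
    (h : Relation.ReflTransGen (M.BoundedStep w B) a c) (hc : M.step w c = none)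
    (hB : ∀ i, c.head i ∈ Set.Icc (0 : ℤ) B) {d : M.Cfg}
    (hd : Relation.ReflTransGen (fun a b => M.step w a = some b) a d) :
    ∀ i, d.head i ∈ Set.Icc (0 : ℤ) B := by
  induction h using Relation.ReflTransGen.head_induction_on generalizing d with
  | refl =>
    rcases hd.cases_head with rfl | ⟨e, he, -⟩
    · exact hB
    · simp [hc] at he
  | head hab _ ih =>
    rcases hd.cases_head with rfl | ⟨e, he, hed⟩
    · exact hab.2
    · rw [hab.1, Option.some_inj] at he
      subst he
      exact ih hed

/-- With a single tape a scanned cell is determined by its position, and determinism confines the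
positions to `0, …, B`. -/
theorem encard_scannedCells_le {M : OfflineTM A} {w : List A} {B : ℕ} {c : M.Cfg}
    (hM : M.tapes = 1)
    (h : Relation.ReflTransGen (M.BoundedStep w B) M.init c) (hc : M.step w c = none)
    (hB : ∀ i, c.head i ∈ Set.Icc (0 : ℤ) B) :
    (M.scannedCells w).encard ≤ ((B + 1 : ℕ) : ℕ∞) := by
  have hinj : Set.InjOn Prod.snd (M.scannedCells w) := by
    have : Subsingleton (Fin M.tapes) := by rw [hM]; infer_instance
    rintro ⟨i, x⟩ - ⟨j, y⟩ - hxy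
    exact Prod.ext (Subsingleton.elim _ _) hxy
  rw [← hinj.encard_image]
  have hsub : Prod.snd '' M.scannedCells w ⊆ (Finset.Icc (0 : ℤ) B : Set ℤ) := by
    rintro _ ⟨⟨i, x⟩, ⟨d, hd, hx⟩, rfl⟩
    have := head_mem_of_boundedStep h hc hB hd i
    simp only at hx ⊢
    rw [← hx]
    simpa using this
  refine (Set.encard_le_encard hsub).trans ?_
  rw [Set.encard_coe_eq_coe_finsetCard]
  simp

end OfflineTM

/-! ## A machine for word problems of groups generated by finite automata -/

/-- A finite transducer over the alphabet `Fin (m + 1)`, with a state for every letter of `A`. -/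
structure Transducer (A : Type*) where
  Q : Type
  finiteQ : Finite Q
  m : ℕ
  out : Q → Fin (m + 1) → Fin (m + 1)
  next : Q → Fin (m + 1) → Q
  letter : A → Q

namespace Transducer

variable {A : Type*} (T : Transducer A)

/-- The action of a state on words. -/
def act : T.Q → List (Fin (T.m + 1)) → List (Fin (T.m + 1))
  | _, [] => []
  | q, y :: v => T.out q y :: act (T.next q y) v

/-- The action of a word over `A`; its last letter acts first. -/
def actWord (w : List A) (v : List (Fin (T.m + 1))) : List (Fin (T.m + 1)) :=
  w.foldr (fun a u => T.act (T.letter a) u) v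

/-- The places where a sweep over the work tape may resume after its return to the left. -/
inductive Phase where
  | count
  | apply
  | advance
  | rewind

/-- The movement of the input head when a phase is entered. -/
def Phase.move : Phase → HeadMove
  | count => .right
  | apply => .left
  | advance => .stay
  | rewind => .stay

/-- The control states of the machine. -/
inductive Control (Q : Type) where
  | start
  | phase (k : Phase)
  | back (k : Phase)
  | increment
  | transform (q : Q)
  | compare
  | halt (b : Bool)

instance : Finite Phase :=
  Finite.of_surjective (fun i : Fin 4 => ![Phase.count, .apply, .advance, .rewind] i) fun k => by
    cases k
    exacts [⟨0, rfl⟩, ⟨1, rfl⟩, ⟨2, rfl⟩, ⟨3, rfl⟩]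

instance {Q : Type} [Finite Q] : Finite (Control Q) :=
  Finite.of_surjective
    (fun s : Fin 3 ⊕ Phase ⊕ Phase ⊕ Q ⊕ Bool => match s with
      | .inl i => ![Control.start, .increment, .compare] i
      | .inr (.inl k) => .phase k
      | .inr (.inr (.inl k)) => .back k
      | .inr (.inr (.inr (.inl q))) => .transform q
      | .inr (.inr (.inr (.inr b))) => .halt b) fun s => by
    cases s with
    | start => exact ⟨.inl 0, rfl⟩
    | phase k => exact ⟨.inr (.inl k), rfl⟩
    | back k => exact ⟨.inr (.inr (.inl k)), rfl⟩
    | increment => exact ⟨.inl 1, rfl⟩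
    | transform q => exact ⟨.inr (.inr (.inr (.inl q))), rfl⟩
    | compare => exact ⟨.inl 2, rfl⟩
    | halt b => exact ⟨.inr (.inr (.inr (.inr b))), rfl⟩

/-- The contents of a work tape cell: a bit of a counter, a letter of the current vertex, and a
letter of its image. -/
abbrev Cell := Bool × Fin (T.m + 1) × Fin (T.m + 1)

/-- The transition function: the symbol `none` is the blank, and `some none` marks the left end of
the work tape. -/
def rule : Control T.Q → InputSymbol A → Option (Option T.Cell) →
    Control T.Q × HeadMove × Option (Option T.Cell) × HeadMove
  | .start, _, _ => (.phase .count, .right, some none, .right)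
  | .phase .count, .letter _, s => (.increment, .stay, s, .stay)
  | .phase .count, _, s => (.phase .apply, .left, s, .stay)
  | .increment, _, some (some (true, v, u)) =>
      (.increment, .stay, some (some (false, v, u)), .right)
  | .increment, _, some (some (false, v, u)) =>
      (.back .count, .stay, some (some (true, v, u)), .left)
  -- A carry into the blank allocates a new cell; its vertex letter and its image letter start at
  -- `0`.
  | .increment, _, _ => (.back .count, .stay, some (some (true, 0, 0)), .left)
  | .back k, _, some none => (.phase k, k.move, some none, .right)
  | .back k, _, s => (.back k, .stay, s, .left)
  | .phase .apply, .letter a, s => (.transform (T.letter a), .stay, s, .stay)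
  | .phase .apply, _, s => (.compare, .stay, s, .stay)
  | .transform q, _, some (some (b, v, u)) =>
      (.transform (T.next q u), .stay, some (some (b, v, T.out q u)), .right)
  | .transform _, _, s => (.back .apply, .stay, s, .left)
  | .compare, _, some (some (b, v, u)) =>
      if v = u then (.compare, .stay, some (some (b, v, u)), .right)
      else (.halt false, .stay, some (some (b, v, u)), .stay)
  | .compare, _, s => (.back .advance, .stay, s, .left)
  | .phase .advance, _, some (some (b, v, _)) =>
      if v = Fin.last T.m then (.phase .advance, .stay, some (some (b, 0, 0)), .right)
      -- The image is reset together with the vertex. The cells further right need no reset, since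
      -- the comparison has just succeeded there.
      else (.back .rewind, .stay, some (some (b, v + 1, v + 1)), .left)
  | .phase .advance, _, s => (.halt true, .stay, s, .stay)
  | .phase .rewind, .rightEnd, s => (.phase .apply, .left, s, .stay)
  | .phase .rewind, _, s => (.phase .rewind, .right, s, .stay)
  | .halt b, _, s => (.halt b, .stay, s, .stay)

/-- The machine decides whether the input acts trivially on all words whose length is the size of
the binary expansion of the length of the input. -/
def machine : OfflineTM A where
  State := Control T.Q
  finiteState := by have := T.finiteQ; infer_instance
  Sym := Option (Option T.Cell)
  finiteSym := inferInstance
  blank := none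
  tapes := 1
  start := .start
  verdict s := match s with
    | .halt b => some b
    | _ => none
  trans s x t := let r := T.rule s x (t 0); (r.1, r.2.1, fun _ => r.2.2)

/-! ### Configurations -/

/-- The tape with a given content, to the right of position `0`. -/
def tape {Γ : Type*} (l : List Γ) (z : ℤ) : Option Γ := if z < 0 then none else l[z.toNat]?

/-- The list that results from writing a symbol at the beginning. -/
def put {Γ : Type*} : Option Γ → List Γ → List Γ
  | none, r => r
  | some b, r => b :: r.tail

theorem tape_length {Γ : Type*} (l r : List Γ) :
    tape (l.reverse ++ r) l.length = r.head? := by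
  have h : ¬ ((l.length : ℤ) < 0) := by omega
  simp [tape, h, List.head?_eq_getElem?, List.getElem?_append_right]

/-- A blank may only be written where nothing follows; otherwise the written part of the tape would
have a gap and not be a list. -/
theorem update_tape {Γ : Type*} (l r : List Γ) (s : Option Γ) (hs : s = none → r = []) :
    Function.update (tape (l.reverse ++ r)) l.length s = tape (l.reverse ++ put s r) := by
  funext z
  rcases eq_or_ne z l.length with rfl | hz
  · rw [Function.update_self, tape_length]
    cases s with
    | none => simp [put, hs rfl]
    | some b => simp [put]
  rw [Function.update_of_ne hz]
  simp only [tape]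
  split_ifs with h0
  · rfl
  lift z to ℕ using not_lt.1 h0
  have hz : z ≠ l.length := by exact_mod_cast hz
  simp only [Int.toNat_natCast]
  rcases lt_or_gt_of_ne hz with h | h
  · rw [List.getElem?_append_left (by simpa), List.getElem?_append_left (by simpa)]
  · rw [List.getElem?_append_right (by simpa using h.le),
      List.getElem?_append_right (by simpa using h.le)]
    cases s with
    | none => simp [put]
    | some b =>
      obtain ⟨k, hk⟩ : ∃ k, z - l.reverse.length = k + 1 :=
        ⟨z - l.length - 1, by simp; omega⟩
      rw [hk]
      simp [put, List.getElem?_tail]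

/-- The configuration with `l` (in reverse) to the left of the head and `r` to the right. -/
def conf (s : Control T.Q) (p : ℕ) (l r : List (Option T.Cell)) : T.machine.Cfg where
  state := s
  inputPos := p
  work := fun _ => tape (l.reverse ++ r)
  head := fun _ => l.length

theorem init_eq : T.machine.init = T.conf .start 0 [] [] := by
  simp only [OfflineTM.init, conf, machine]
  congr
  funext _ z
  simp [tape]

/-- Reduces a step to one value of `rule` and to list bookkeeping: `hl` is the new tape content and
`hh` places the head in it. Since `l'.length` is a natural number, `hh` also keeps the head from
passing position `0` to the left. -/
theorem step_conf {w : List A} {s s' : Control T.Q} {p : ℕ} {l l' r r' : List (Option T.Cell)}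
    {mv hm : HeadMove} {t : Option (Option T.Cell)}
    (h : T.rule s (OfflineTM.inputSymbol w p) r.head? = (s', mv, t, hm))
    (hs : ∀ b, s ≠ .halt b) (ht : t = none → r = [])
    (hl : l'.reverse ++ r' = l.reverse ++ put t r) (hh : (l'.length : ℤ) = l.length + hm.shift) :
    T.machine.step w (T.conf s p l r)
      = some (T.conf s' (OfflineTM.moveInput w.length p mv) l' r') := by
  have hv : T.machine.verdict s = none := by
    cases s <;> simp_all [machine]
  simp only [OfflineTM.step, conf, hv]
  simp only [machine, tape_length, h]
  congr
  · funext i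
    rw [hl]
    exact update_tape l r t ht
  · funext i
    exact hh.symm

variable {T}

/-- The work tape holds the mark and the cells `ds ++ cs`, and the head is at the first of the cells
`cs`. -/
def sweep (s : Control T.Q) (p : ℕ) (ds cs : List T.Cell) : T.machine.Cfg :=
  T.conf s p (ds.reverse.map some ++ [none]) (cs.map some)

/-! ### Single sweeps over the work tape -/

section

variable {w : List A} {s s' : Control T.Q} {p B : ℕ} {mv : HeadMove} {ds cs : List T.Cell}
  {a b : T.Cell} {k : Phase}

theorem boundedStep_conf {l r l' r' : List (Option T.Cell)}
    {hm : HeadMove} {t : Option (Option T.Cell)}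
    (h : T.rule s (OfflineTM.inputSymbol w p) r.head? = (s', mv, t, hm))
    (hs : ∀ b, s ≠ .halt b) (hB : l.length ≤ B) (ht : t = none → r = [])
    (hl : l'.reverse ++ r' = l.reverse ++ put t r) (hh : (l'.length : ℤ) = l.length + hm.shift) :
    T.machine.BoundedStep w B (T.conf s p l r)
      (T.conf s' (OfflineTM.moveInput w.length p mv) l' r') :=
  ⟨T.step_conf h hs ht hl hh, fun _ => by simpa [conf] using hB⟩

theorem sweep_stay {t : Option (Option T.Cell)}
    (h : T.rule s (OfflineTM.inputSymbol w p) t = (s', mv, t, .stay))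
    (hs : ∀ b, s ≠ .halt b) (hB : ds.length + 1 ≤ B) (ht : t = cs.head?.map some) :
    T.machine.BoundedStep w B (sweep s p ds cs)
      (sweep s' (OfflineTM.moveInput w.length p mv) ds cs) := by
  subst ht
  refine boundedStep_conf (t := cs.head?.map some) (hm := .stay) ?_ hs (by simpa) ?_ ?_ ?_
  · rw [List.head?_map]; exact h
  · cases cs <;> simp
  · cases cs <;> simp [put]
  · simp [HeadMove.shift]

theorem sweep_right
    (h : T.rule s (OfflineTM.inputSymbol w p) (some (some a)) = (s', mv, some (some b), .right))
    (hs : ∀ b, s ≠ .halt b) (hB : ds.length + 1 ≤ B) :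
    T.machine.BoundedStep w B (sweep s p ds (a :: cs))
      (sweep s' (OfflineTM.moveInput w.length p mv) (ds ++ [b]) cs) :=
  boundedStep_conf h hs (by simpa) (by simp) (by simp [put]) (by simp [HeadMove.shift])

theorem back_reach (l : List (Option T.Cell)) {r : List (Option T.Cell)}
    (h : l.reverse ++ r = none :: cs.map some) (hr : r ≠ []) (hB : cs.length + 1 ≤ B) :
    Relation.ReflTransGen (T.machine.BoundedStep w B) (T.conf (.back k) p l r)
      (sweep (.phase k) (OfflineTM.moveInput w.length p k.move) [] cs) := by
  have hlen := congrArg List.length h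
  simp only [List.length_append, List.length_reverse, List.length_cons, List.length_map] at hlen
  induction l generalizing r with
  | nil =>
    simp only [List.reverse_nil, List.nil_append] at h
    subst h
    exact .single (boundedStep_conf (t := some none) (hm := .right) (by simp [rule])
      (by simp) (by simp) (by simp) (by simp [put]) (by simp [HeadMove.shift]))
  | cons c l ih =>
    obtain ⟨a, r, rfl⟩ := List.exists_cons_of_ne_nil hr
    -- Only the first cell carries the mark, so a scanned symbol with something to its left is an
    -- ordinary cell and the head moves on.
    obtain ⟨a, rfl⟩ : ∃ a', a = some a' := by
      cases hl : (c :: l).reverse with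
      | nil => simp at hl
      | cons d l' =>
        rw [hl] at h
        simp only [List.cons_append, List.cons.injEq] at h
        have : a ∈ cs.map some := by rw [← h.2]; simp
        obtain ⟨x, -, hx⟩ := List.mem_map.1 this
        exact ⟨x, hx.symm⟩
    refine .head (boundedStep_conf (s' := .back k) (l' := l) (r' := c :: some a :: r)
      (t := some (some a)) (hm := .left) (mv := .stay) (by simp [rule])
      (by simp) ?_ (by simp) (by simp [put]) (by simp [HeadMove.shift])) ?_
    · simp at hlen ⊢; omega
    · exact ih (by simpa using h) (by simp) (by simp at hlen ⊢; omega)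

/-- Common end of every sweep that returns to the mark: a last write, then the way back. Here `es`
stands for the cells from the head on after that write, which covers both a change inside the tape
and the arrival at the blank. -/
theorem conf_left_back {t : Option (Option T.Cell)} {r : List (Option T.Cell)}
    {es : List T.Cell}
    (h : T.rule s (OfflineTM.inputSymbol w p) r.head? = (.back k, .stay, t, .left))
    (hs : ∀ b, s ≠ .halt b) (ht : t = none → r = [])
    (hes : put t r = es.map some) (hB : (ds ++ es).length + 1 ≤ B) :
    Relation.ReflTransGen (T.machine.BoundedStep w B)
      (T.conf s p (ds.reverse.map some ++ [none]) r)
      (sweep (.phase k) (OfflineTM.moveInput w.length p k.move) [] (ds ++ es)) := by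
  obtain ⟨c, l, hl⟩ : ∃ c l, ds.reverse.map some ++ [none] = c :: l :=
    List.exists_cons_of_ne_nil (by simp)
  have hrev : (c :: l).reverse = none :: ds.map some := by rw [← hl]; simp
  rw [hl]
  refine .head (boundedStep_conf (l' := l) (r' := c :: put t r) h hs ?_ ht (by simp)
    (by simp [HeadMove.shift])) ?_
  · rw [← hl]; simp at hB ⊢; omega
  · exact back_reach l (by rw [hes]; simpa using congrArg (· ++ es.map some) hrev) (by simp) hB

theorem sweep_back
    (h : T.rule s (OfflineTM.inputSymbol w p) (some (some a)) =
      (.back k, .stay, some (some b), .left))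
    (hs : ∀ b, s ≠ .halt b) (hB : ds.length + cs.length + 2 ≤ B) :
    Relation.ReflTransGen (T.machine.BoundedStep w B) (sweep s p ds (a :: cs))
      (sweep (.phase k) (OfflineTM.moveInput w.length p k.move) [] (ds ++ b :: cs)) :=
  conf_left_back (t := some (some b)) h hs (by simp) (by simp [put]) (by simp; omega)

/-- The list `es` is empty if the blank is kept, and a single new cell if the counter grows. -/
theorem sweep_nil_back {es : List T.Cell}
    (h : T.rule s (OfflineTM.inputSymbol w p) none =
      (.back k, .stay, es.head?.map some, .left)) (hes : es.length ≤ 1)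
    (hs : ∀ b, s ≠ .halt b) (hB : ds.length + es.length + 1 ≤ B) :
    Relation.ReflTransGen (T.machine.BoundedStep w B) (sweep s p ds [])
      (sweep (.phase k) (OfflineTM.moveInput w.length p k.move) [] (ds ++ es)) := by
  refine conf_left_back h hs (by simp) ?_ (by simpa)
  match es, hes with
  | [], _ => simp [put]
  | [e], _ => simp [put]

end

end Transducer

namespace Transducer

variable {A : Type*} {T : Transducer A}

/-! ### The binary counter -/

/-- Increment of the counter. -/
def increment : List T.Cell → List T.Cell
  | [] => [(true, 0, 0)]
  | (true, v, u) :: cs => (false, v, u) :: increment cs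
  | (false, v, u) :: cs => (true, v, u) :: cs

/-- The cells of the counter with value `n`. -/
def counter (n : ℕ) : List T.Cell := n.bits.map fun b => (b, 0, 0)

theorem length_counter (n : ℕ) : (counter n : List T.Cell).length = n.size := by
  simp [counter, Nat.size_eq_bits_len]

/-- The lowest bit comes first, so passing from `2 * k + 1` to `2 * (k + 1)` is a carry into the
counter for `k`. -/
theorem increment_counter (n : ℕ) :
    increment (counter n : List T.Cell) = counter (n + 1) := by
  induction n using Nat.strong_induction_on with
  | _ n ih =>
    rcases Nat.eq_zero_or_pos n with rfl | hn
    · simp [counter, increment]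
    rcases Nat.even_or_odd' n with ⟨k, rfl | rfl⟩
    · simp only [counter]
      rw [Nat.bit0_bits k (by omega), Nat.bit1_bits]
      simp [increment]
    · have h := ih k (by omega)
      simp only [counter] at h ⊢
      rw [show 2 * k + 1 + 1 = 2 * (k + 1) by ring, Nat.bit0_bits (k + 1) (by omega),
        Nat.bit1_bits]
      simp [increment, h]

section

variable {w : List A} {p B : ℕ}

theorem increment_reach (cs ds : List T.Cell) (hB : ds.length + (increment cs).length + 1 ≤ B) :
    Relation.ReflTransGen (T.machine.BoundedStep w B) (sweep .increment p ds cs)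
      (sweep (.phase .count) (OfflineTM.moveInput w.length p .right) [] (ds ++ increment cs)) := by
  induction cs generalizing ds with
  | nil => exact sweep_nil_back (by simp [rule, increment]) (by simp [increment]) (by simp) hB
  | cons c cs ih =>
    obtain ⟨_ | _, v, u⟩ := c
    · exact sweep_back (by simp [rule]) (by simp) (by simp [increment] at hB; omega)
    · refine .head (sweep_right (s' := .increment) (b := (false, v, u)) (mv := .stay)
        (by simp only [rule])
        (by simp) (by omega)) ?_
      have := ih (ds ++ [(false, v, u)]) (by simp [increment] at hB ⊢; omega)
      simpa [increment] using this

theorem count_reach (n : ℕ) (hn : n ≤ w.length) (hB : w.length.size + 1 ≤ B) :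
    Relation.ReflTransGen (T.machine.BoundedStep w B) T.machine.init
      (sweep (.phase .count) (n + 1) [] (counter n)) := by
  induction n with
  | zero =>
    rw [init_eq]
    refine .single ?_
    have h := boundedStep_conf (T := T) (w := w) (s := .start) (p := 0) (B := B) (l := []) (r := [])
      (l' := [none]) (r' := []) (s' := .phase .count) (mv := .right) (t := some none)
      (hm := .right) (by simp [rule]) (by simp) (by simp) (by simp) (by simp [put])
      (by simp [HeadMove.shift])
    simpa [sweep, counter, OfflineTM.moveInput] using h
  | succ n ih =>
    have hs : (counter (n + 1) : List T.Cell).length ≤ w.length.size := by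
      rw [length_counter]; exact Nat.size_le_size hn
    refine (ih (by omega)).trans (.head (sweep_stay (s' := .increment) (mv := .stay)
      (t := (counter n).head?.map some) ?_ (by simp) (by simp; omega) rfl) ?_)
    · simp [OfflineTM.inputSymbol, List.getElem?_eq_getElem (show n < w.length by omega), rule]
    · have h := increment_reach (T := T) (w := w) (p := n + 1) (B := B) (counter n) []
        (by rw [increment_counter]; simp; omega)
      rw [increment_counter] at h
      rw [show OfflineTM.moveInput w.length (n + 1) .right = n + 1 + 1 by
        simp [OfflineTM.moveInput]; omega] at h
      exact h

theorem inputSymbol_length_add_one : OfflineTM.inputSymbol w (w.length + 1) = .rightEnd := by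
  simp [OfflineTM.inputSymbol]

/-- Only the number of cells matters from here on: there are `w.length.size` of them, all with the
letter `0`, which is the first vertex to be tested. Later phases carry the bits along without using
them. -/
theorem counted_reach (hB : w.length.size + 1 ≤ B) :
    Relation.ReflTransGen (T.machine.BoundedStep w B) T.machine.init
      (sweep (.phase .apply) w.length [] (counter w.length)) := by
  refine (count_reach w.length le_rfl hB).tail ?_
  exact sweep_stay (mv := .left) (t := (counter w.length).head?.map some)
    (by rw [inputSymbol_length_add_one]; simp [rule]) (by simp) (by simp; omega) rfl

/-! ### The action of the input -/

/-- The action of a state on the images that are stored in the cells. -/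
def transform : T.Q → List T.Cell → List T.Cell
  | _, [] => []
  | q, (b, v, u) :: cs => (b, v, T.out q u) :: transform (T.next q u) cs

theorem length_transform (q : T.Q) (cs : List T.Cell) :
    (transform q cs).length = cs.length := by
  induction cs generalizing q with
  | nil => rfl
  | cons c cs ih => simp [transform, ih]

theorem transform_reach (q : T.Q) (cs ds : List T.Cell) (hB : ds.length + cs.length + 1 ≤ B) :
    Relation.ReflTransGen (T.machine.BoundedStep w B) (sweep (.transform q) p ds cs)
      (sweep (.phase .apply) (p - 1) [] (ds ++ transform q cs)) := by
  induction cs generalizing ds q with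
  | nil => exact sweep_nil_back (es := []) (by simp [rule]) (by simp) (by simp) hB
  | cons c cs ih =>
    obtain ⟨b, v, u⟩ := c
    refine .head (sweep_right (s' := .transform (T.next q u)) (b := (b, v, T.out q u))
      (mv := .stay) (by simp only [rule])
        (by simp) (by omega)) ?_
    have := ih (T.next q u) (ds ++ [(b, v, T.out q u)]) (by simp at hB ⊢; omega)
    simpa [transform] using this

/-- The action of a word on the images that are stored in the cells. -/
def transformWord (w : List A) (cs : List T.Cell) : List T.Cell :=
  w.foldr (fun a => transform (T.letter a)) cs

/-- The input position `n` is also the number of letters that have yet to act, because the last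
letter acts first; the left end marker at position `0` ends the phase. -/
theorem apply_reach (n : ℕ) (hn : n ≤ w.length) (cs : List T.Cell) (hB : cs.length + 1 ≤ B) :
    Relation.ReflTransGen (T.machine.BoundedStep w B) (sweep (.phase .apply) n [] cs)
      (sweep .compare 0 [] (transformWord (w.take n) cs)) := by
  induction n generalizing cs with
  | zero =>
    exact .single (sweep_stay (mv := .stay) (t := cs.head?.map some)
      (by simp [OfflineTM.inputSymbol, rule]) (by simp) (by simp; omega) rfl)
  | succ n ih =>
    have hlt : n < w.length := by omega
    refine .head (sweep_stay (s' := .transform (T.letter w[n])) (mv := .stay)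
      (t := cs.head?.map some) (by simp [OfflineTM.inputSymbol, hlt, rule]) (by simp)
      (by simp; omega) rfl) ?_
    refine (transform_reach (T.letter w[n]) cs [] (by simpa)).trans ?_
    have h := ih (by omega) (transform (T.letter w[n]) cs) (by rwa [length_transform])
    have heq : transformWord (w.take (n + 1)) cs =
        transformWord (w.take n) (transform (T.letter w[n]) cs) := by
      rw [List.take_succ_eq_append_getElem hlt]
      simp only [transformWord, List.foldr_append, List.foldr_cons, List.foldr_nil]
    rw [heq]
    exact h

/-! ### The comparison of the vertex with its image -/

theorem compare_reach (cs ds : List T.Cell) (hB : ds.length + cs.length + 1 ≤ B)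
    (h : ∀ c ∈ cs, c.2.1 = c.2.2) :
    Relation.ReflTransGen (T.machine.BoundedStep w B) (sweep .compare p ds cs)
      (sweep (.phase .advance) p [] (ds ++ cs)) := by
  induction cs generalizing ds with
  | nil => exact sweep_nil_back (es := []) (by simp [rule]) (by simp) (by simp) hB
  | cons c cs ih =>
    obtain ⟨b, v, u⟩ := c
    obtain rfl : v = u := h (b, v, u) (by simp)
    refine .head (sweep_right (s' := .compare) (b := (b, v, v)) (mv := .stay) (by simp [rule])
        (by simp) (by omega)) ?_
    have := ih (ds ++ [(b, v, v)]) (by simp at hB ⊢; omega) fun c hc => h c (by simp [hc])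
    simpa using this

theorem compare_reject (cs ds : List T.Cell) (hB : ds.length + cs.length + 1 ≤ B)
    (h : ¬ ∀ c ∈ cs, c.2.1 = c.2.2) :
    ∃ ds' cs', Relation.ReflTransGen (T.machine.BoundedStep w B) (sweep .compare p ds cs)
      (sweep (.halt false) p ds' cs') ∧ ds'.length + 1 ≤ B := by
  induction cs generalizing ds with
  | nil => simp at h
  | cons c cs ih =>
    obtain ⟨b, v, u⟩ := c
    by_cases hvu : v = u
    · subst hvu
      obtain ⟨ds', cs', h', hB'⟩ := ih (ds ++ [(b, v, v)]) (by simp at hB ⊢; omega)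
        (by simpa using h)
      exact ⟨ds', cs', .head (sweep_right (b := (b, v, v)) (mv := .stay) (by simp [rule])
        (by simp) (by omega)) h', hB'⟩
    · exact ⟨ds, (b, v, u) :: cs, .single (sweep_stay (mv := .stay) (t := some (some (b, v, u)))
        (by simp [rule, hvu]) (by simp) (by omega) rfl), by omega⟩

/-! ### The enumeration of the vertices -/

/-- The cells with the next vertex, if there is one. -/
def advance : List T.Cell → Option (List T.Cell)
  | [] => none
  | (b, v, _) :: cs =>
    if v = Fin.last T.m then (advance cs).map ((b, 0, 0) :: ·)
    else some ((b, v + 1, v + 1) :: cs)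

theorem advance_reach (cs ds : List T.Cell) (hB : ds.length + cs.length + 1 ≤ B)
    {cs' : List T.Cell} (h : advance cs = some cs') :
    Relation.ReflTransGen (T.machine.BoundedStep w B) (sweep (.phase .advance) p ds cs)
      (sweep (.phase .rewind) p [] (ds ++ cs')) := by
  induction cs generalizing ds cs' with
  | nil => simp [advance] at h
  | cons c cs ih =>
    obtain ⟨b, v, u⟩ := c
    by_cases hv : v = Fin.last T.m
    · simp only [advance, hv, if_true, Option.map_eq_some_iff] at h
      obtain ⟨cs₁, h₁, rfl⟩ := h
      refine .head (sweep_right (s' := .phase .advance) (b := (b, 0, 0)) (mv := .stay)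
        (by simp [rule, hv])       (by simp) (by omega)) ?_
      have := ih (ds ++ [(b, 0, 0)]) (by simp at hB ⊢; omega) h₁
      simpa using this
    · simp only [advance, hv, if_false, Option.some_inj] at h
      subst h
      exact sweep_back (by simp [rule, hv]) (by simp) (by simp at hB; omega)

theorem advance_accept (cs ds : List T.Cell) (hB : ds.length + cs.length + 1 ≤ B)
    (h : advance cs = none) :
    ∃ ds' cs', Relation.ReflTransGen (T.machine.BoundedStep w B) (sweep (.phase .advance) p ds cs)
      (sweep (.halt true) p ds' cs') ∧ ds'.length + 1 ≤ B := by
  induction cs generalizing ds with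
  | nil =>
    exact ⟨ds, [], .single (sweep_stay (mv := .stay) (t := none)
      (by simp [rule]) (by simp) (by simpa using hB) rfl), by simpa using hB⟩
  | cons c cs ih =>
    obtain ⟨b, v, u⟩ := c
    by_cases hv : v = Fin.last T.m
    · simp only [advance, hv, if_true, Option.map_eq_none_iff] at h
      obtain ⟨ds', cs', h', hB'⟩ := ih (ds ++ [(b, 0, 0)]) (by simp at hB ⊢; omega) h
      exact ⟨ds', cs', .head (sweep_right (b := (b, 0, 0)) (mv := .stay) (by simp [rule, hv])
        (by simp) (by omega)) h', hB'⟩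
    · simp [advance, hv] at h

theorem rewind_reach (cs : List T.Cell) (hB : 1 ≤ B) (j : ℕ) (hp : p + j = w.length + 1) :
    Relation.ReflTransGen (T.machine.BoundedStep w B) (sweep (.phase .rewind) p [] cs)
      (sweep (.phase .apply) w.length [] cs) := by
  induction j generalizing p with
  | zero =>
    obtain rfl : p = w.length + 1 := hp
    exact .single (sweep_stay (mv := .left) (t := cs.head?.map some)
      (by rw [inputSymbol_length_add_one]; simp [rule]) (by simp) (by simpa) rfl)
  | succ j ih =>
    have h : OfflineTM.inputSymbol w p ≠ .rightEnd := by
      cases p with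
      | zero => simp [OfflineTM.inputSymbol]
      | succ p =>
        simp [OfflineTM.inputSymbol, List.getElem?_eq_getElem (show p < w.length by omega)]
    have hmv : OfflineTM.moveInput w.length p .right = p + 1 := by
      simp [OfflineTM.moveInput]; omega
    refine .head (sweep_stay (s' := .phase .rewind) (mv := .right) (t := cs.head?.map some)
      ?_ (by simp) (by simpa) rfl) ?_
    · cases hx : OfflineTM.inputSymbol w p <;> simp_all [rule]
    · rw [hmv]
      exact ih (by omega)

end

/-! ### The main loop -/

/-- The vertex that is stored in the cells. -/
def vertex (cs : List T.Cell) : List (Fin (T.m + 1)) := cs.map fun c => c.2.1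

/-- The number that is represented by a vertex. -/
def value (v : List (Fin (T.m + 1))) : ℕ := Nat.ofDigits (T.m + 1) (v.map Fin.val)

theorem value_cons (y : Fin (T.m + 1)) (v : List (Fin (T.m + 1))) :
    value (y :: v) = y + (T.m + 1) * value v := by
  simp [value, Nat.ofDigits_cons]

theorem value_injective {v v' : List (Fin (T.m + 1))} (hl : v.length = v'.length)
    (h : value v = value v') : v = v' := by
  induction v generalizing v' with
  | nil => exact (List.length_eq_zero_iff.1 hl.symm).symm
  | cons y v ih =>
    obtain ⟨y', v', rfl⟩ := List.exists_cons_of_length_eq_add_one hl.symm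
    rw [value_cons, value_cons] at h
    have hy : y = y' := by
      have := congrArg (· % (T.m + 1)) h
      simp only [Nat.add_mul_mod_self_left, Nat.mod_eq_of_lt y.2, Nat.mod_eq_of_lt y'.2] at this
      exact Fin.ext this
    subst hy
    rw [ih (by simpa using hl) (Nat.eq_of_mul_eq_mul_left (by omega) (Nat.add_left_cancel h))]

theorem value_lt (v : List (Fin (T.m + 1))) : value v + 1 ≤ (T.m + 1) ^ v.length := by
  induction v with
  | nil => simp [value]
  | cons y v ih =>
    rw [value_cons, List.length_cons, pow_succ']
    have := Nat.mul_le_mul_left (T.m + 1) ih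
    have := y.2
    nlinarith

/-- The odometer adds one in base `T.m + 1`, lowest digit first: a last letter turns into `0` and
carries. -/
theorem value_advance {cs cs' : List T.Cell} (h : advance cs = some cs') :
    value (vertex cs') = value (vertex cs) + 1 := by
  induction cs generalizing cs' with
  | nil => simp [advance] at h
  | cons c cs ih =>
    obtain ⟨b, v, u⟩ := c
    by_cases hv : v = Fin.last T.m
    · simp only [advance, hv, if_true, Option.map_eq_some_iff] at h
      obtain ⟨cs₁, h₁, rfl⟩ := h
      have := ih h₁
      simp only [vertex, List.map_cons, value_cons] at this ⊢
      rw [this, hv, Fin.val_last, Fin.val_zero]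
      ring
    · simp only [advance, hv, if_false, Option.some_inj] at h
      subst h
      simp only [vertex, List.map_cons, value_cons]
      rw [Fin.val_add_one_of_lt (lt_of_le_of_ne (Fin.le_last v) hv)]
      ring

theorem value_of_advance_eq_none {cs : List T.Cell} (h : advance cs = none) :
    value (vertex cs) + 1 = (T.m + 1) ^ cs.length := by
  induction cs with
  | nil => simp [vertex, value]
  | cons c cs ih =>
    obtain ⟨b, v, u⟩ := c
    by_cases hv : v = Fin.last T.m
    · simp only [advance, hv, if_true, Option.map_eq_none_iff] at h
      have := ih h
      simp only [vertex, List.map_cons, value_cons, List.length_cons] at this ⊢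
      rw [pow_succ', ← this, hv, Fin.val_last]
      ring
    · simp [advance, hv] at h

theorem length_advance {cs cs' : List T.Cell} (h : advance cs = some cs') :
    cs'.length = cs.length := by
  induction cs generalizing cs' with
  | nil => simp [advance] at h
  | cons c cs ih =>
    obtain ⟨b, v, u⟩ := c
    by_cases hv : v = Fin.last T.m
    · simp only [advance, hv, if_true, Option.map_eq_some_iff] at h
      obtain ⟨cs₁, h₁, rfl⟩ := h
      simp [ih h₁]
    · simp only [advance, hv, if_false, Option.some_inj] at h
      subst h
      simp

/-- Invariant of the main loop: every pass begins with the image equal to the vertex. -/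
theorem forall_mem_advance {cs cs' : List T.Cell} (h : advance cs = some cs')
    (hcs : ∀ c ∈ cs, c.2.1 = c.2.2) : ∀ c ∈ cs', c.2.1 = c.2.2 := by
  induction cs generalizing cs' with
  | nil => simp [advance] at h
  | cons c cs ih =>
    obtain ⟨b, v, u⟩ := c
    by_cases hv : v = Fin.last T.m
    · simp only [advance, hv, if_true, Option.map_eq_some_iff] at h
      obtain ⟨cs₁, h₁, rfl⟩ := h
      simpa using ih h₁ fun c hc => hcs c (by simp [hc])
    · simp only [advance, hv, if_false, Option.some_inj] at h
      subst h
      exact List.forall_mem_cons.2 ⟨rfl, fun c hc => hcs c (by simp [hc])⟩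

/-- The cells with the bits of `cs`, the vertex of `cs` and the image `u`. -/
def withImage (cs : List T.Cell) (u : List (Fin (T.m + 1))) : List T.Cell :=
  List.zipWith (fun c y => (c.1, c.2.1, y)) cs u

theorem transform_withImage (q : T.Q) (cs : List T.Cell) (u : List (Fin (T.m + 1))) :
    transform q (withImage cs u) = withImage cs (T.act q u) := by
  induction cs generalizing q u with
  | nil => simp [withImage, transform]
  | cons c cs ih =>
    cases u with
    | nil => simp [withImage, transform, act]
    | cons y u => simpa [withImage, transform, act] using ih _ u

theorem transformWord_withImage (w : List A) (cs : List T.Cell) (u : List (Fin (T.m + 1))) :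
    transformWord w (withImage cs u) = withImage cs (T.actWord w u) := by
  induction w with
  | nil => rfl
  | cons a w ih =>
    simp only [transformWord, actWord, List.foldr_cons] at ih ⊢
    rw [ih, transform_withImage]

theorem withImage_vertex {cs : List T.Cell} (h : ∀ c ∈ cs, c.2.1 = c.2.2) :
    withImage cs (vertex cs) = cs := by
  induction cs with
  | nil => rfl
  | cons c cs ih =>
    have hc := h c (by simp)
    have := ih fun c hc => h c (by simp [hc])
    simp only [withImage, vertex, List.map_cons, List.zipWith_cons_cons] at this ⊢
    rw [this]
    congr 1
    exact Prod.ext rfl (Prod.ext rfl hc)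

theorem forall_mem_withImage {cs : List T.Cell} {u : List (Fin (T.m + 1))}
    (hl : u.length = cs.length) :
    (∀ c ∈ withImage cs u, c.2.1 = c.2.2) ↔ u = vertex cs := by
  induction cs generalizing u with
  | nil => simp [withImage, vertex, List.length_eq_zero_iff.1 hl]
  | cons c cs ih =>
    obtain ⟨y, u, rfl⟩ := List.exists_cons_of_length_eq_add_one hl
    have := ih (u := u) (by simpa using hl)
    simp only [withImage, vertex, List.map_cons, List.zipWith_cons_cons, List.forall_mem_cons,
      List.cons.injEq] at this ⊢
    rw [this, eq_comm]

theorem length_act (q : T.Q) (v : List (Fin (T.m + 1))) : (T.act q v).length = v.length := by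
  induction v generalizing q with
  | nil => rfl
  | cons y v ih => simp [act, ih]

theorem length_actWord (w : List A) (v : List (Fin (T.m + 1))) :
    (T.actWord w v).length = v.length := by
  induction w with
  | nil => rfl
  | cons a w ih =>
    simp only [actWord, List.foldr_cons, length_act] at ih ⊢
    exact ih

variable {w : List A} {B : ℕ}

/-- Induction on `N`, the number of vertices from the current one on, in the order of their values;
the verdict concerns exactly these vertices. -/
theorem loop_reach (N : ℕ) (cs : List T.Cell) (hB : cs.length + 1 ≤ B)
    (hN : value (vertex cs) + N = (T.m + 1) ^ cs.length) (hcs : ∀ c ∈ cs, c.2.1 = c.2.2) :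
    ∃ b p ds' cs', Relation.ReflTransGen (T.machine.BoundedStep w B)
      (sweep (.phase .apply) w.length [] cs) (sweep (.halt b) p ds' cs') ∧ ds'.length + 1 ≤ B ∧
      (b = true ↔ ∀ v, v.length = cs.length → value (vertex cs) ≤ value v →
        T.actWord w v = v) := by
  have hlen : (vertex cs).length = cs.length := by simp [vertex]
  induction N generalizing cs with
  | zero =>
    -- The current vertex is itself counted, so `N = 0` is impossible.
    have := value_lt (vertex cs)
    rw [hlen] at this
    omega
  | succ N ih =>
    have happ := apply_reach (T := T) (w := w) w.length le_rfl cs hB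
    rw [List.take_length, ← congrArg (transformWord w) (withImage_vertex hcs),
      transformWord_withImage] at happ
    have hiff := forall_mem_withImage (cs := cs) (u := T.actWord w (vertex cs))
      (by rw [length_actWord, hlen])
    have hlen' : (withImage cs (T.actWord w (vertex cs))).length = cs.length := by
      simp [withImage, length_actWord, hlen]
    by_cases hfix : T.actWord w (vertex cs) = vertex cs
    · have hcomp := compare_reach (T := T) (w := w) (p := 0) (B := B) _ []
        (by rw [hlen']; simpa) (hiff.2 hfix)
      rw [hfix, withImage_vertex hcs] at happ hcomp
      have hr := happ.trans hcomp
      rw [List.nil_append] at hr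
      cases hadv : advance cs with
      | none =>
        obtain ⟨ds', cs', h', hB'⟩ := advance_accept (w := w) (p := 0) (B := B) cs []
          (by simpa) hadv
        refine ⟨true, 0, ds', cs', hr.trans h', hB', fun _ v hv hle => ?_, fun _ => rfl⟩
        -- The odometer overflows only at the largest value, so the current vertex is the only one
        -- left.
        have h1 := value_of_advance_eq_none hadv
        have h2 := value_lt v
        rw [hv] at h2
        have : vertex cs = v := value_injective (by rw [hlen, hv]) (by omega)
        rw [← this, hfix]
      | some cs₁ =>
        have hl₁ := length_advance hadv
        have hv₁ := value_advance hadv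
        have hadv' := advance_reach (w := w) (p := 0) (B := B) cs [] (by simpa) hadv
        have hrew := rewind_reach (T := T) (w := w) (p := 0) (B := B) cs₁ (by omega)
          (w.length + 1) (by omega)
        obtain ⟨b, p, ds', cs', h', hB', hb⟩ := ih cs₁ (by omega) (by rw [hv₁, hl₁]; omega)
          (forall_mem_advance hadv hcs) (by simp [vertex])
        refine ⟨b, p, ds', cs', (hr.trans hadv').trans (hrew.trans h'), hB', hb.trans ?_⟩
        rw [hl₁, hv₁]
        refine ⟨fun h v hv hle => ?_, fun h v hv hle => h v hv (by omega)⟩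
        rcases hle.eq_or_lt with he | hlt
        · rw [← value_injective (by rw [hlen, hv]) he, hfix]
        · exact h v hv hlt
    · obtain ⟨ds', cs', h', hB'⟩ := compare_reject (T := T) (w := w) (p := 0) (B := B) _ []
        (by rw [hlen']; simpa) (mt hiff.1 hfix)
      refine ⟨false, 0, ds', cs', happ.trans h', hB',
        fun h => by simp at h, fun h => (hfix (h _ hlen le_rfl)).elim⟩

variable (T)

/-- A language is decidable in logarithmic space if its words are those that fix all vertices of a
logarithmic depth, for an action that is given by a finite transducer. -/
theorem inLogspace {L : Language A}
    (hL : ∀ w, w ∈ L ↔ ∀ v, v.length = w.length.size → T.actWord w v = v) : InLogspace L := by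
  have key : ∀ w : List A, ∃ b p ds cs, Relation.ReflTransGen
      (T.machine.BoundedStep w (w.length.size + 1)) T.machine.init (sweep (.halt b) p ds cs) ∧
      ds.length + 1 ≤ w.length.size + 1 ∧ (b = true ↔ w ∈ L) := by
    intro w
    -- The enumeration starts at value `0`, so that no vertex of this depth is left out.
    have hv : value (vertex (counter w.length : List T.Cell)) = 0 := by
      simp only [counter, vertex, List.map_map, value]
      generalize w.length.bits = l
      induction l with
      | nil => simp
      | cons x l ih => simpa [Nat.ofDigits_cons] using ih
    obtain ⟨b, p, ds, cs, h, hB, hb⟩ := loop_reach (T := T) (w := w) (B := w.length.size + 1)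
      _ (counter w.length) (by rw [length_counter]) (by rw [hv, zero_add])
      (by simp [counter])
    refine ⟨b, p, ds, cs, (counted_reach le_rfl).trans h, hB, ?_⟩
    rw [hb, hL, length_counter, hv]
    simp
  have hhalt : ∀ (w : List A) b p (ds cs : List T.Cell),
      T.machine.step w (sweep (.halt b) p ds cs) = none := fun _ _ _ _ _ => rfl
  -- The head stays in `0, …, size + 1`, and `size + 2 ≤ log + 3 ≤ 3 * (log + 1)`.
  refine ⟨T.machine, 3, fun w => ?_, fun w => ?_⟩
  · obtain ⟨b, p, ds, cs, h, -, hb⟩ := key w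
    refine ⟨_, OfflineTM.visits_of_boundedStep h, ?_⟩
    cases b with
    | true => exact .inl ⟨hb.1 rfl, rfl⟩
    | false => exact .inr ⟨fun hw => by simpa using hb.2 hw, rfl⟩
  · obtain ⟨b, p, ds, cs, h, hB, -⟩ := key w
    refine (OfflineTM.encard_scannedCells_le rfl h (hhalt _ _ _ _ _) ?_).trans ?_
    · intro i
      simp only [sweep, conf, Set.mem_Icc]
      simp
      omega
    · have : w.length.size ≤ Nat.log 2 w.length + 1 := by
        rw [Nat.size_le]
        exact Nat.lt_pow_succ_log_self (by norm_num) _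
      exact_mod_cast (by omega)

end Transducer

/-! ## States of tree automorphisms -/

namespace TreeAut

variable {X : Type*}

theorem length_apply (g : TreeAut X) (v : List X) : (g v).length = v.length := by
  induction v generalizing g with
  | nil => simp [g.apply_nil]
  | cons x v ih =>
    obtain ⟨y, hy⟩ := g.exists_apply_singleton x
    rw [g.apply_cons_eq, hy, List.length_append, ih]
    simp [add_comm]

theorem apply_append (g : TreeAut X) (u v : List X) : g (u ++ v) = g u ++ g.stateAt u v := by
  induction u generalizing g with
  | nil => simp [g.apply_nil, stateAt]
  | cons x u ih =>
    rw [List.cons_append, g.apply_cons_eq, ih, g.apply_cons_eq x u, List.append_assoc]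
    rfl

theorem stateAt_append (g : TreeAut X) (u v : List X) :
    g.stateAt (u ++ v) = (g.stateAt u).stateAt v :=
  List.foldl_append

theorem stateAt_mul (g h : TreeAut X) (v : List X) :
    (g * h).stateAt v = g.stateAt (h v) * h.stateAt v := by
  ext u : 1
  have h1 := (g * h).apply_append v u
  rw [RelIso.mul_apply, h.apply_append, g.apply_append, RelIso.mul_apply] at h1
  exact (List.append_cancel_left h1).symm

theorem stateAt_one (v : List X) : (1 : TreeAut X).stateAt v = 1 := by
  ext u : 1
  exact (List.append_cancel_left ((1 : TreeAut X).apply_append v u)).symm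

/-- The automorphism fixes all vertices of depth `n`. -/
def FixesLevel (g : TreeAut X) (n : ℕ) : Prop := ∀ v : List X, v.length = n → g v = v

theorem FixesLevel.apply_eq {g : TreeAut X} {n : ℕ} (h : g.FixesLevel n) {v : List X}
    (hv : v.length ≤ n) : g v = v := by
  cases v with
  | nil => exact g.apply_nil
  | cons x v =>
    -- The vertex is prolonged to depth `n` by its own first letter, so `X` need not be assumed
    -- nonempty; automorphisms preserve prefixes.
    have h1 := h (x :: v ++ List.replicate (n - (x :: v).length) x) (by simp at hv ⊢; omega)
    rw [apply_append] at h1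
    exact List.append_inj_left h1 (g.length_apply _)

theorem FixesLevel.eq_one_of_stateAt {g : TreeAut X} {n : ℕ} (h : g.FixesLevel n)
    (h1 : ∀ v : List X, v.length = n → g.stateAt v = 1) : g = 1 := by
  have key : ∀ m, g.FixesLevel (n + m) := by
    intro m v hv
    have hl : (v.take n).length = n := by simp; omega
    rw [← List.take_append_drop n v, apply_append, h _ hl, h1 _ hl]
    rfl
  ext v : 1
  exact (key v.length).apply_eq (Nat.le_add_left _ _)

theorem FixesLevel.stateAt {g : TreeAut X} {n m : ℕ} (h : g.FixesLevel (n + m)) {v : List X}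
    (hv : v.length = n) : (g.stateAt v).FixesLevel m := by
  intro u hu
  have h1 := h (v ++ u) (by simp [hv, hu])
  rw [apply_append, h.apply_eq (by omega)] at h1
  exact List.append_cancel_left h1

/-- The nontrivial elements of a finite set act nontrivially on all levels that are deep enough. -/
theorem exists_forall_eq_one {B : Set (TreeAut X)} (hB : B.Finite) :
    ∃ m, ∀ g ∈ B, ∀ n, m ≤ n → g.FixesLevel n → g = 1 := by
  induction B, hB using Set.Finite.induction_on with
  | empty => simp
  | @insert a s _ _ ih =>
    obtain ⟨m, hm⟩ := ih
    by_cases ha : a = 1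
    · refine ⟨m, fun g hg n hn h => ?_⟩
      rcases hg with rfl | hg
      exacts [ha, hm g hg n hn h]
    · obtain ⟨v, hv⟩ : ∃ v, a v ≠ v := by
        by_contra! h
        exact ha (RelIso.ext h)
      refine ⟨max m v.length, fun g hg n hn h => ?_⟩
      rcases hg with rfl | hg
      · exact (hv (h.apply_eq ((le_max_right _ _).trans hn))).elim
      · exact hm g hg n ((le_max_left _ _).trans hn) h

end TreeAut

open TreeAut

/-! ### Halving the length of products -/

section Contracting

variable {X : Type*} {G : Subgroup (TreeAut X)}

theorem IsSelfSimilar.stateAt_mem (hG : IsSelfSimilar G) {g : TreeAut X} (hg : g ∈ G)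
    (v : List X) : g.stateAt v ∈ G := by
  induction v generalizing g with
  | nil => exact hg
  | cons x v ih => exact ih (hG g hg x)

/-- A finite subset of a contracting self-similar group lies in a finite set `B` that contains all
states of its elements, and all states of products of two of its elements at some level. -/
theorem IsContracting.exists_finite_superset [Finite X] (hG : IsContracting G)
    (hself : IsSelfSimilar G) {F : Set (TreeAut X)} (hF : F.Finite) (hFG : F ⊆ G) :
    ∃ B : Set (TreeAut X), B.Finite ∧ F ⊆ B ∧ (∀ g ∈ B, ∀ v, g.stateAt v ∈ B) ∧
      ∃ k, ∀ g ∈ B, ∀ h ∈ B, ∀ v : List X, v.length = k → (g * h).stateAt v ∈ B := by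
  obtain ⟨N, hNG, hN, hcontr⟩ := hG
  -- Short words are finite in number, and long words have their states in `N`.
  have hfin : ∀ g ∈ G, (Set.range g.stateAt).Finite := by
    intro g hg
    obtain ⟨n, hn⟩ := hcontr g hg
    refine (((List.finite_length_lt X n).image g.stateAt).union hN).subset ?_
    rintro _ ⟨v, rfl⟩
    rcases lt_or_ge v.length n with h | h
    exacts [.inl ⟨v, h, rfl⟩, .inr (hn v h)]
  have hFN : F ∪ N ⊆ G := Set.union_subset hFG hNG
  have hsub : F ∪ N ⊆ ⋃ g ∈ F ∪ N, Set.range g.stateAt := fun g hg =>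
    Set.mem_biUnion hg ⟨[], rfl⟩
  have hBfin : (⋃ g ∈ F ∪ N, Set.range g.stateAt).Finite :=
    (hF.union hN).biUnion fun g hg => hfin g (hFN hg)
  have hBG : ∀ g ∈ ⋃ g ∈ F ∪ N, Set.range g.stateAt, g ∈ G := by
    simp only [Set.mem_iUnion]
    rintro _ ⟨g, hg, v, rfl⟩
    exact hself.stateAt_mem (hFN hg) v
  -- The set `B` consists of all states of elements of `F ∪ N`. It contains `N`, which is what
  -- absorbs the states of products.
  refine ⟨_, hBfin, Set.subset_union_left.trans hsub, ?_, ?_⟩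
  · simp only [Set.mem_iUnion]
    rintro _ ⟨g, hg, v, rfl⟩ u
    exact ⟨g, hg, v ++ u, g.stateAt_append v u⟩
  · have hP := (hBfin.prod hBfin)
    have : ∀ p : TreeAut X × TreeAut X, ∃ n, p.1 ∈ G → p.2 ∈ G →
        ∀ v : List X, n ≤ v.length → (p.1 * p.2).stateAt v ∈ N := by
      intro p
      by_cases h : p.1 ∈ G ∧ p.2 ∈ G
      · obtain ⟨n, hn⟩ := hcontr _ (mul_mem h.1 h.2)
        exact ⟨n, fun _ _ => hn⟩
      · exact ⟨0, fun h1 h2 => (h ⟨h1, h2⟩).elim⟩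
    choose f hf using this
    -- The contraction depth varies with the pair; finitely many pairs allow a common `k`.
    obtain ⟨k, hk⟩ := (hP.image f).bddAbove
    refine ⟨k, fun g hg h hh v hv => hsub (.inr ?_)⟩
    exact hf (g, h) (hBG g hg) (hBG h hh) v (by
      rw [hv]; exact hk ⟨(g, h), ⟨hg, hh⟩, rfl⟩)

variable {B : Set (TreeAut X)} {k : ℕ}

/-- Factors are taken in pairs: the state of `a * b * p` at `v` is the state of `a * b` at `p v`
times the state of `p` at `v`, and `p v` again has length `k`. An unpaired last factor is replaced
by its own state, whence the `+ 1`. -/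
theorem exists_stateAt_prod_eq_prod (hst : ∀ g ∈ B, ∀ v, g.stateAt v ∈ B)
    (hk : ∀ g ∈ B, ∀ h ∈ B, ∀ v : List X, v.length = k → (g * h).stateAt v ∈ B)
    {v : List X} (hv : v.length = k) : ∀ l : List (TreeAut X), (∀ g ∈ l, g ∈ B) →
    ∃ l' : List (TreeAut X), (∀ g ∈ l', g ∈ B) ∧ 2 * l'.length ≤ l.length + 1 ∧
      l.prod.stateAt v = l'.prod
  | [], _ => ⟨[], by simp, by simp, by simp [stateAt_one]⟩
  | [a], h => ⟨[a.stateAt v], by simpa using hst a (h a (by simp)) v, by simp, by simp⟩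
  | a :: b :: l, h => by
    obtain ⟨l', h1, h2, h3⟩ := exists_stateAt_prod_eq_prod hst hk hv l
      fun g hg => h g (by simp [hg])
    refine ⟨(a * b).stateAt (l.prod v) :: l', ?_, by simp; omega, ?_⟩
    · rw [List.forall_mem_cons]
      exact ⟨hk a (h a (by simp)) b (h b (by simp)) _ (by rw [length_apply, hv]), h1⟩
    · rw [List.prod_cons, List.prod_cons, ← mul_assoc, stateAt_mul, h3, List.prod_cons]

/-- Each block of `k` letters of `v` halves the bound `2 ^ n`, and `n` blocks leave at most one
factor; `1 ∈ B` serves the empty product. -/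
theorem stateAt_prod_mem (h1 : 1 ∈ B) (hst : ∀ g ∈ B, ∀ v, g.stateAt v ∈ B)
    (hk : ∀ g ∈ B, ∀ h ∈ B, ∀ v : List X, v.length = k → (g * h).stateAt v ∈ B)
    (n : ℕ) (l : List (TreeAut X)) (hl : ∀ g ∈ l, g ∈ B) (hn : l.length ≤ 2 ^ n)
    {v : List X} (hv : v.length = k * n) : l.prod.stateAt v ∈ B := by
  induction n generalizing l v with
  | zero =>
    match l, hl, hn with
    | [], _, _ => simpa [stateAt_one] using h1
    | [a], hl, _ => simpa using hst a (hl a (by simp)) v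
  | succ n ih =>
    rw [Nat.mul_succ] at hv
    obtain ⟨l', h2, h3, h4⟩ := exists_stateAt_prod_eq_prod hst hk (v := v.take k)
      (by simp; omega) l hl
    rw [← List.take_append_drop k v, stateAt_append, h4]
    exact ih l' h2 (by rw [pow_succ] at hn; omega) (by simp; omega)

/-- A product of fewer than `2 ^ n` elements of `B` is trivial if it fixes a level whose depth is
linear in `n`. -/
theorem exists_prod_eq_one_iff (hfin : B.Finite) (h1 : 1 ∈ B)
    (hst : ∀ g ∈ B, ∀ v, g.stateAt v ∈ B)
    (hk : ∀ g ∈ B, ∀ h ∈ B, ∀ v : List X, v.length = k → (g * h).stateAt v ∈ B) :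
    ∃ C, ∀ (n : ℕ) (l : List (TreeAut X)), (∀ g ∈ l, g ∈ B) → l.length < 2 ^ n →
      (l.prod = 1 ↔ l.prod.FixesLevel (C * n)) := by
  obtain ⟨m, hm⟩ := exists_forall_eq_one hfin
  -- The first `k * n` levels bring the states into `B`; the other `m * n` detect whether they are
  -- trivial. The latter needs `m ≤ m * n`, so `n = 0`, where the list is empty, is separate.
  refine ⟨k + m, fun n l hl hn => ⟨fun h => by rw [h]; exact fun _ _ => rfl, fun h => ?_⟩⟩
  rcases Nat.eq_zero_or_pos n with rfl | hpos
  · have : l = [] := by simpa using hn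
    simp [this]
  rw [add_mul] at h
  refine FixesLevel.eq_one_of_stateAt (n := k * n)
    (fun v hv => h.apply_eq (hv.le.trans (Nat.le_add_right _ _))) fun v hv => ?_
  exact hm _ (stateAt_prod_mem h1 hst hk n l hl hn.le hv) (m * n)
    (Nat.le_mul_of_pos_right m hpos) (h.stateAt hv)

end Contracting

/-! ## Word problems of contracting groups -/

/-! ### Words of length `C` as letters -/

section Blocks

variable {X Y : Type*} {C : ℕ}

/-- The concatenation of a list of words. -/
def concatBlocks (e : Y → List X) (v : List Y) : List X := (v.map e).flatten

theorem concatBlocks_injective {e : Y → List X} (he : Function.Injective e)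
    (hC : ∀ y, (e y).length = C) {v v' : List Y} (hl : v.length = v'.length)
    (h : concatBlocks e v = concatBlocks e v') : v = v' := by
  induction v generalizing v' with
  | nil => exact (List.length_eq_zero_iff.1 hl.symm).symm
  | cons y v ih =>
    obtain ⟨y', v', rfl⟩ := List.exists_cons_of_length_eq_add_one hl.symm
    simp only [concatBlocks, List.map_cons, List.flatten_cons] at h ih
    obtain ⟨h1, h2⟩ := List.append_inj h (by rw [hC, hC])
    rw [he h1, ih (by simpa using hl) h2]

theorem length_concatBlocks {e : Y → List X} (hC : ∀ y, (e y).length = C) (v : List Y) :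
    (concatBlocks e v).length = C * v.length := by
  induction v with
  | nil => simp [concatBlocks]
  | cons y v ih =>
    simp only [concatBlocks, List.map_cons, List.flatten_cons, List.length_append,
      List.length_cons, hC] at ih ⊢
    rw [ih, Nat.mul_succ, add_comm]

theorem exists_concatBlocks_eq {e : Y → List X} (he : ∀ u : List X, u.length = C → ∃ y, e y = u)
    (n : ℕ) {u : List X} (hu : u.length = C * n) :
    ∃ v : List Y, v.length = n ∧ concatBlocks e v = u := by
  induction n generalizing u with
  | zero => exact ⟨[], rfl, (List.length_eq_zero_iff.1 hu).symm⟩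
  | succ n ih =>
    rw [Nat.mul_succ] at hu
    obtain ⟨y, hy⟩ := he (u.take C) (by simp; omega)
    obtain ⟨v, hv, hvu⟩ := ih (u := u.drop C) (by simp; omega)
    refine ⟨y :: v, by simp [hv], ?_⟩
    simp only [concatBlocks, List.map_cons, List.flatten_cons] at hvu ⊢
    rw [hy, hvu, List.take_append_drop]

end Blocks

/-- A language is decidable in logarithmic space if its words are those whose products fix all
vertices of a logarithmic depth, for letters from a finite set of automorphisms that is closed under
states. -/
theorem inLogspace_of_fixesLevel {X A : Type*} [Finite X] {B : Set (TreeAut X)} (hfin : B.Finite)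
    (hst : ∀ g ∈ B, ∀ v, g.stateAt v ∈ B) (f : A → TreeAut X) (hf : ∀ a, f a ∈ B) (C : ℕ)
    {L : Language A}
    (hL : ∀ w, w ∈ L ↔ (w.map f).prod.FixesLevel (C * w.length.size)) : InLogspace L := by
  rcases isEmpty_or_nonempty X with hX | ⟨⟨x₀⟩⟩
  -- Over an empty alphabet the tree is only its root and every word lies in `L`. Transducer
  -- alphabets are nonempty, so a trivial one on a single letter takes over.
  · let T : Transducer A := ⟨Unit, inferInstance, 0, fun _ y => y, fun q _ => q, fun _ => ()⟩
    refine T.inLogspace fun w => ⟨fun _ v _ => ?_, fun _ => (hL w).2 fun v _ => ?_⟩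
    · exact List.ext_getElem (T.length_actWord w v) fun _ _ _ => Subsingleton.elim (α := Fin 1) _ _
    · exact Subsingleton.elim _ _
  have : Finite B := hfin
  have : Finite {v : List X // v.length = C} := List.finite_length_eq X C
  have hne : Nonempty {v : List X // v.length = C} := ⟨⟨List.replicate C x₀, by simp⟩⟩
  obtain ⟨m, hm⟩ : ∃ m, Nat.card {v : List X // v.length = C} = m + 1 :=
    Nat.exists_eq_add_one_of_ne_zero Nat.card_pos.ne'
  let eY : {v : List X // v.length = C} ≃ Fin (m + 1) := Finite.equivFinOfCardEq hm
  let eQ : B ≃ Fin (Nat.card B) := Finite.equivFin B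
  let T : Transducer A :=
    { Q := Fin (Nat.card B)
      finiteQ := inferInstance
      m := m
      out := fun q y => eY ⟨(eQ.symm q).1 (eY.symm y).1, by
        rw [length_apply]; exact (eY.symm y).2⟩
      next := fun q y => eQ ⟨(eQ.symm q).1.stateAt (eY.symm y).1, hst _ (eQ.symm q).2 _⟩
      letter := fun a => eQ ⟨f a, hf a⟩ }
  let e : Fin (m + 1) → List X := fun y => (eY.symm y).1
  have hout : ∀ (q : T.Q) y, e (T.out q y) = (eQ.symm q).1 (e y) := fun _ _ =>
    congrArg Subtype.val (eY.symm_apply_apply _)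
  have hnext : ∀ (q : T.Q) y, (eQ.symm (T.next q y)).1 = (eQ.symm q).1.stateAt (e y) :=
    fun _ _ => congrArg Subtype.val (eQ.symm_apply_apply _)
  have hletter : ∀ a, (eQ.symm (T.letter a)).1 = f a := fun _ =>
    congrArg Subtype.val (eQ.symm_apply_apply _)
  -- Decoding each letter to its block of length `C` turns the transducer action into the tree
  -- action, so depth `n` over blocks is depth `C * n` in `X^*`.
  have hact : ∀ (q : T.Q) (v : List (Fin (m + 1))),
      concatBlocks e (T.act q v) = (eQ.symm q).1 (concatBlocks e v) := by
    intro q v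
    induction v generalizing q with
    | nil => exact ((eQ.symm q).1.apply_nil).symm
    | cons y v ih =>
      have h := ih (T.next q y)
      simp only [concatBlocks, Transducer.act, List.map_cons, List.flatten_cons] at h ⊢
      rw [h, apply_append, hnext, hout]
  have hword : ∀ (w : List A) (v : List (Fin (m + 1))),
      concatBlocks e (T.actWord w v) = (w.map f).prod (concatBlocks e v) := by
    intro w v
    induction w with
    | nil => rfl
    | cons a w ih =>
      simp only [Transducer.actWord, List.foldr_cons, List.map_cons, List.prod_cons,
        RelIso.mul_apply] at ih ⊢
      rw [hact, ih, hletter]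
  have hC : ∀ y, (e y).length = C := fun y => (eY.symm y).2
  have he : Function.Injective e := Subtype.val_injective.comp eY.symm.injective
  refine T.inLogspace fun w => (hL w).trans ⟨fun h v hv => ?_, fun h u hu => ?_⟩
  · refine concatBlocks_injective he hC (T.length_actWord w v) ?_
    rw [hword]
    exact h _ (by rw [length_concatBlocks hC, hv])
  · obtain ⟨v, hv, rfl⟩ := exists_concatBlocks_eq (e := e)
      (fun u hu => ⟨eY ⟨u, hu⟩, by simp [e]⟩) _ hu
    rw [← hword, h v hv]

theorem mainTheorem12 {X : Type*} [Finite X] (G : Subgroup (TreeAut X)) (hfg : G.FG)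
    (hself : IsSelfSimilar G) (hcontr : IsContracting G) :
    ∀ (S : Type*) [Finite S] (π : FreeGroup S →* G), Function.Surjective π →
      InLogspace (wordProblem π) ∧
      ∃ C : ℕ, ∀ w : List (StdLetter S),
        wordValue π w = 1 ↔
          ∀ v : List X, v.length = C * (Nat.log 2 w.length + 1) →
            ((wordValue π w : G) : TreeAut X) v = v := by
  intro S _ π _
  have hS : Finite (StdLetter S) :=
    Finite.of_surjective (fun s : Option (S ⊕ S) => match s with
      | none => StdLetter.one
      | some (.inl s) => .gen s
      | some (.inr s) => .inv s) fun a => by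
      cases a with
      | one => exact ⟨none, rfl⟩
      | gen s => exact ⟨some (.inl s), rfl⟩
      | inv s => exact ⟨some (.inr s), rfl⟩
  let f : StdLetter S → TreeAut X := fun a => (π a.toFree : G)
  obtain ⟨B, hfin, hFB, hst, k, hk⟩ := hcontr.exists_finite_superset hself (Set.finite_range f)
    (by rintro _ ⟨a, rfl⟩; exact (π a.toFree).2)
  have hf : ∀ a, f a ∈ B := fun a => hFB ⟨a, rfl⟩
  have h1 : 1 ∈ B := by simpa [f, StdLetter.toFree] using hf .one
  obtain ⟨C, hC⟩ := exists_prod_eq_one_iff hfin h1 hst hk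
  have hval : ∀ w : List (StdLetter S), ((wordValue π w : G) : TreeAut X) = (w.map f).prod := by
    intro w
    simp only [wordValue, SubmonoidClass.coe_list_prod, List.map_map]
    rfl
  -- Any such `n` will do, with one and the same `C`: the machine uses `w.length.size`, the depth
  -- bound uses `Nat.log 2 w.length + 1`. As `Nat.log 2 0 = 0`, the empty word fits in.
  have key : ∀ (w : List (StdLetter S)) (n : ℕ), w.length < 2 ^ n →
      (wordValue π w = 1 ↔ (w.map f).prod.FixesLevel (C * n)) := by
    intro w n hn
    rw [← hC n (w.map f) (by simpa using fun a _ => hf a) (by simpa using hn), ← hval]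
    exact Subtype.ext_iff
  refine ⟨inLogspace_of_fixesLevel hfin hst f hf C fun w => key w _ (Nat.lt_size_self _),
    C, fun w => ?_⟩
  rw [hval]
  exact key w _ (Nat.lt_pow_succ_log_self (by norm_num) _)
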